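/- Let $N\ge 1$, $\mathcal H_A=\mathcal H_B=\mathbb C^N$. Let $\mathcal E_A,\mathcal E_B$ be quantum channels (CPTP maps given by finite Kraus families) on operators on $\mathcal H_A$, $\mathcal H_B$, let $\mathcal M_a$ and $\mathcal M_b$ be elements of finite POVMs on $\mathcal H_A$ and $\mathcal H_B$, and put $\mathcal K_a=\mathcal E_A^\dagger(\mathcal M_a)$, $\mathcal K_b=\mathcal E_B^\dagger(\mathcal M_b)$, $\mathcal K_\phi=\mathcal K_a\otimes\mathcal K_b$. For real $s$ let $\mathbb H_s$ be the set of pure states of $\mathcal H_A\otimes\mathcal H_B$ whose entanglement entropy (the von Neumann entropy, with natural logarithm, of the reduced state on $\mathcal H_A$) is at least $s$, and let $$J_{\max}(\mathcal K_\phi,s)=\max_{|\psi\rangle\in\mathbb H_s}\langle\psi|\mathcal K_\phi|\psi\rangle .$$ Let $\alpha_1\ge\dots\ge\alpha_N\ge 0$ and $\beta_1\ge\dots\ge\beta_N\ge 0$ be the eigenvalues of $\mathcal K_a$ and $\mathcal K_b$ with multiplicity, $\mu_j=\alpha_j\beta_j$, $d_{\max}=\#\{j:\mu_j=\mu_1\}$,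 let $\sigma_{\max}(\mathcal K_\phi)$ be the largest eigenvalue of $\mathcal K_\phi$, and $Z(\gamma)=\sum_{j=1}^N e^{\gamma\mu_j}$. Say that a probability vector $\lambda\in\mathbb R^N$ is optimal for $s$ if for all orthonormal eigenbases $(a_j)$ of $\mathcal K_a$ and $(b_j)$ of $\mathcal K_b$ ordered as the $\alpha_j$ and $\beta_j$, the state $\sum_j\sqrt{\lambda_j}\,a_j\otimes b_j$ lies in $\mathbb H_s$ and attains $J_{\max}(\mathcal K_\phi,s)$. For every $s\le\log N$ the maximum defining $J_{\max}(\mathcal K_\phi,s)$ exists, and the following hold. (i) If $s\le\log d_{\max}$, then $J_{\max}(\mathcal K_\phi,s)=\mu_1=\sigma_{\max}(\mathcal K_\phi)$, and the vector with $\lambda_j=1/d_{\max}$ for $j\le d_{\max}$ and $\lambda_j=0$ for $j>d_{\max}$ is optimal for $s$. (ii) If $\log d_{\max}<s\le\log N$, then the entropy equation $$\log Z(\gamma)-\frac{\gamma}{Z(\gamma)}\sum_{j=1}^N\mu_je^{\gamma\mu_j}=s$$ has a unique solution $\gamma\ge 0$; one has $\gamma>0$ if and only if $s<\log N$. Moreover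 $$J_{\max}(\mathcal K_\phi,s)=\frac1{Z(\gamma)}\sum_{j=1}^N\mu_je^{\gamma\mu_j}<\sigma_{\max}(\mathcal K_\phi),$$ and the Gibbs vector $\lambda_j=e^{\gamma\mu_j}/Z(\gamma)$ is optimal for $s$. (iii) $s\mapsto J_{\max}(\mathcal K_\phi,s)$ is strictly decreasing on $[\log d_{\max},\log N]$. -/

import Mathlib

open scoped Matrix Kronecker ComplexOrder

namespace PrivacyEnergy

noncomputable section

/-- Operators on the Hilbert space `ℂ^ι` (`ι = Fin N` for one subsystem, `Fin N × Fin N` for the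
composite system), in the standard basis. -/
abbrev Op (ι : Type*) := Matrix ι ι ℂ

/-- A quantum channel (CPTP map) on operators on `ℂ^N`, given by a finite Kraus family. -/
structure QuantumChannel (κ : Type*) [Fintype κ] (N : ℕ) where
  kraus : κ → Op (Fin N)
  sum_adjoint_mul : ∑ k, (kraus k)ᴴ * kraus k = 1

/-- The action `ρ ↦ ∑ E_k ρ E_k†` of the channel. -/
def QuantumChannel.apply {κ : Type*} [Fintype κ] {N : ℕ} (E : QuantumChannel κ N)
    (ρ : Op (Fin N)) : Op (Fin N) :=
  ∑ k, E.kraus k * ρ * (E.kraus k)ᴴ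

/-- The adjoint map `M ↦ ∑ E_k† M E_k` of the channel. -/
def QuantumChannel.adjoint {κ : Type*} [Fintype κ] {N : ℕ} (E : QuantumChannel κ N)
    (M : Op (Fin N)) : Op (Fin N) :=
  ∑ k, (E.kraus k)ᴴ * M * E.kraus k

/-- `adjoint` is the adjoint of `apply` for the trace pairing. -/
theorem QuantumChannel.trace_mul_apply {κ : Type*} [Fintype κ] {N : ℕ} (E : QuantumChannel κ N)
    (M ρ : Op (Fin N)) : (M * E.apply ρ).trace = (E.adjoint M * ρ).trace := by
  simp only [QuantumChannel.apply, QuantumChannel.adjoint, Finset.mul_sum, Finset.sum_mul,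
    Matrix.trace_sum]
  refine Finset.sum_congr rfl fun k _ => ?_
  rw [← Matrix.mul_assoc, Matrix.trace_mul_comm]
  simp only [Matrix.mul_assoc]

/-- A POVM with finite outcome set `O` on `ℂ^N`. -/
structure POVM (O : Type*) [Fintype O] (N : ℕ) where
  elem : O → Op (Fin N)
  posSemidef : ∀ o, (elem o).PosSemidef
  sum_elem : ∑ o, elem o = 1

/-- The induced local observable `K_o = E†(M_o)`. -/
def inducedObservable {κ O : Type*} [Fintype κ] [Fintype O] {N : ℕ}
    (E : QuantumChannel κ N) (M : POVM O N) (o : O) : Op (Fin N) :=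
  E.adjoint (M.elem o)

theorem isHermitian_inducedObservable {κ O : Type*} [Fintype κ] [Fintype O] {N : ℕ}
    (E : QuantumChannel κ N) (M : POVM O N) (o : O) :
    (inducedObservable E M o).IsHermitian := by
  have h := (M.posSemidef o).isHermitian.eq
  simp only [Matrix.IsHermitian, inducedObservable, QuantumChannel.adjoint,
    Matrix.conjTranspose_sum, Matrix.conjTranspose_mul, Matrix.conjTranspose_conjTranspose, h,
    Matrix.mul_assoc]

/-- The `j`-th largest eigenvalue (with multiplicity, `j` counted from `0`). -/
def sortedEigenvalue {N : ℕ} {K : Op (Fin N)} (hK : K.IsHermitian) (j : Fin N) : ℝ :=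
  hK.eigenvalues₀ (Fin.cast (Fintype.card_fin N).symm j)

/-- The largest eigenvalue of a Hermitian operator. -/
def sigmaMax {ι : Type*} [Fintype ι] [DecidableEq ι] (K : Op ι) : ℝ :=
  sSup (spectrum ℝ K)

/-- The partial trace over the second subsystem. -/
def partialTraceB {N : ℕ} (ρ : Op (Fin N × Fin N)) : Op (Fin N) :=
  Matrix.of fun i i' => ∑ j, ρ (i, j) (i', j)

theorem isHermitian_partialTraceB {N : ℕ} {ρ : Op (Fin N × Fin N)} (hρ : ρ.IsHermitian) :
    (partialTraceB ρ).IsHermitian := by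
  ext i i'
  simp only [partialTraceB, Matrix.conjTranspose_apply, Matrix.of_apply, star_sum]
  exact Finset.sum_congr rfl fun j _ => hρ.apply _ _

/-- The von Neumann entropy `-∑ λ_j log λ_j` over the eigenvalues (natural logarithm). -/
def vonNeumannEntropy {N : ℕ} {ρ : Op (Fin N)} (hρ : ρ.IsHermitian) : ℝ :=
  -∑ j, hρ.eigenvalues j * Real.log (hρ.eigenvalues j)

/-- The entanglement entropy: von Neumann entropy of the reduced state on the first subsystem. -/
def entanglementEntropy {N : ℕ} {ρ : Op (Fin N × Fin N)} (hρ : ρ.IsHermitian) : ℝ :=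
  vonNeumannEntropy (isHermitian_partialTraceB hρ)

/-- `ℍ_s`: pure (rank-one) density operators with entanglement entropy at least `s`. -/
def pureStates (N : ℕ) (s : ℝ) : Set (Op (Fin N × Fin N)) :=
  {ρ | ∃ hρ : ρ.PosSemidef, ρ.trace = 1 ∧ ρ.rank = 1 ∧ s ≤ entanglementEntropy hρ.isHermitian}

/-- The kets `ψ` whose projector `|ψ⟩⟨ψ|` lies in `ℍ_s`. -/
def kets (N : ℕ) (s : ℝ) : Set (EuclideanSpace ℂ (Fin N × Fin N)) :=
  {ψ | Matrix.vecMulVec ψ.ofLp (star ψ.ofLp) ∈ pureStates N s}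

/-- The privacy energy `⟨ψ|K|ψ⟩` (a real number for Hermitian `K`). -/
def energy {ι : Type*} [Fintype ι] (K : Op ι) (ψ : EuclideanSpace ℂ ι) : ℝ :=
  (star ψ.ofLp ⬝ᵥ (K *ᵥ ψ.ofLp)).re

/-- The maximal privacy energy over `ℍ_s`. -/
def Jmax {N : ℕ} (K : Op (Fin N × Fin N)) (s : ℝ) : ℝ :=
  sSup (energy K '' kets N s)

/-- The number of indices `j` with `μ_j` equal to the first entry of `μ`. -/
def dMax {N : ℕ} [NeZero N] (μ : Fin N → ℝ) : ℕ :=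
  (Finset.univ.filter fun j : Fin N => μ j = μ 0).card

/-- The partition function `Z(γ) = ∑ e^{γ μ_j}`. -/
def Z {N : ℕ} (μ : Fin N → ℝ) (γ : ℝ) : ℝ :=
  ∑ j, Real.exp (γ * μ j)

/-- The entropy equation for `γ`. -/
def EntropyEq {N : ℕ} (μ : Fin N → ℝ) (s γ : ℝ) : Prop :=
  Real.log (Z μ γ) - γ / Z μ γ * ∑ j, μ j * Real.exp (γ * μ j) = s

/-- `a` is an orthonormal basis of eigenvectors of `K`, in decreasing order of the eigenvalues. -/
def IsSortedEigenbasis {N : ℕ} {K : Op (Fin N)} (hK : K.IsHermitian)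
    (a : OrthonormalBasis (Fin N) ℂ (EuclideanSpace ℂ (Fin N))) : Prop :=
  ∀ j, K *ᵥ (a j).ofLp = (sortedEigenvalue hK j : ℂ) • (a j).ofLp

/-- The state `∑ √λ_j |a_j⟩ ⊗ |b_j⟩`. -/
def schmidtState {N : ℕ} (a b : OrthonormalBasis (Fin N) ℂ (EuclideanSpace ℂ (Fin N)))
    (lam : Fin N → ℝ) : EuclideanSpace ℂ (Fin N × Fin N) :=
  WithLp.toLp 2 fun p => ∑ j, (Real.sqrt (lam j) : ℂ) * (a j p.1 * b j p.2)

/-- The Schmidt weights `lam`, in sorted eigenbases of `Ka` and `Kb` (that is, without further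
local rotations), give a state of `ℍ_s` that maximizes the energy of `Ka ⊗ Kb` over `ℍ_s`. -/
def IsOptimalWeight {N : ℕ} {Ka Kb : Op (Fin N)} (hKa : Ka.IsHermitian) (hKb : Kb.IsHermitian)
    (s : ℝ) (lam : Fin N → ℝ) : Prop :=
  (∀ j, 0 ≤ lam j) ∧ ∑ j, lam j = 1 ∧
  ∀ a b : OrthonormalBasis (Fin N) ℂ (EuclideanSpace ℂ (Fin N)),
    IsSortedEigenbasis hKa a → IsSortedEigenbasis hKb b →
      schmidtState a b lam ∈ kets N s ∧
        IsMaxOn (energy (Ka ⊗ₖ Kb)) (kets N s) (schmidtState a b lam)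

end

end PrivacyEnergy

/-!
In eigenbases ordered by eigenvalue, a ket with coefficient matrix `Y` has energy
`∑ α_i β_j |Y_ij|²`. By Schur's inequality the partial row and column sums of `|Y_ij|²` are at most
the partial sums of the Schmidt weights `λ`, so two summations by parts bound the energy by
`∑ λ_j μ_j`, with equality for `∑ √λ_j a_j ⊗ b_j`. It remains to maximize a linear functional over
the probability vectors of entropy at least `s`. The Gibbs variational principle
`H(λ) + γ ⟨λ, μ⟩ ≤ log Z(γ)` shows that a Gibbs vector of entropy `s` is a maximizer, and such a
vector exists because its entropy decreases from `log N` at `γ = 0` to `log d_max` as `γ → ∞`.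
-/

namespace PrivacyEnergy

section Entropy

open Real Filter Topology

/-- The Shannon entropy `-∑ p_j log p_j` of a weight vector, in natural units. -/
noncomputable def shannonEntropy {ι : Type*} [Fintype ι] (p : ι → ℝ) : ℝ :=
  ∑ j, negMulLog (p j)

/-- The probability vectors of Shannon entropy at least `s`: the classical counterpart of `ℍ_s`. -/
def entropySuperlevel (ι : Type*) [Fintype ι] (s : ℝ) : Set (ι → ℝ) :=
  {p ∈ stdSimplex ℝ ι | s ≤ shannonEntropy p}

/-- The Gibbs vector `e^{γ μ_j} / Z(γ)`; large `γ > 0` favours the largest entries of `μ`. -/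
noncomputable def gibbs {ι : Type*} [Fintype ι] (μ : ι → ℝ) (γ : ℝ) (j : ι) : ℝ :=
  exp (γ * μ j) / ∑ i, exp (γ * μ i)

/-- The uniform probability vector on `S`. -/
noncomputable def uniformWeights {ι : Type*} [DecidableEq ι] (S : Finset ι) (j : ι) : ℝ :=
  if j ∈ S then 1 / (S.card : ℝ) else 0

/-- The level set `{j | μ j = c}` as a `Finset`. -/
noncomputable abbrev levelSet {ι : Type*} [Fintype ι] (μ : ι → ℝ) (c : ℝ) : Finset ι :=
  Finset.univ.filter fun j => μ j = c

variable {ι : Type*} [Fintype ι] {p q μ : ι → ℝ} {γ γ' s c : ℝ} {i j : ι}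

theorem shannonEntropy_lt_neg_sum_mul_log (hp : p ∈ stdSimplex ℝ ι) (hq : q ∈ stdSimplex ℝ ι)
    (hq_pos : ∀ j, 0 < q j) (hpq : p ≠ q) : shannonEntropy p < -∑ j, p j * log (q j) := by
  have term_eq (j : ι) : q j * InformationTheory.klFun (p j / q j)
      = q j - p j - p j * log (q j) - negMulLog (p j) := by
    rcases (hp.1 j).eq_or_lt with h | h
    · simp [← h, InformationTheory.klFun]
    · have := (hq_pos j).ne'
      rw [InformationTheory.klFun, log_div h.ne' this, negMulLog]
      field_simp
      ring
  have term_nonneg (j : ι) : 0 ≤ q j * InformationTheory.klFun (p j / q j) :=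
    mul_nonneg (hq.1 j) (InformationTheory.klFun_nonneg (div_nonneg (hp.1 j) (hq.1 j)))
  obtain ⟨i, hi⟩ := Function.ne_iff.1 hpq
  have term_ne : q i * InformationTheory.klFun (p i / q i) ≠ 0 := by
    rw [Ne, mul_eq_zero, InformationTheory.klFun_eq_zero_iff (div_nonneg (hp.1 i) (hq.1 i)),
      div_eq_one_iff_eq (hq_pos i).ne']
    exact not_or.2 ⟨(hq_pos i).ne', hi⟩
  have sum_pos : 0 < ∑ j, q j * InformationTheory.klFun (p j / q j) :=
    Finset.sum_pos' (fun j _ => term_nonneg j)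
      ⟨i, Finset.mem_univ i, (term_nonneg i).lt_of_ne' term_ne⟩
  simp only [term_eq, Finset.sum_sub_distrib, hp.2, hq.2] at sum_pos
  rw [shannonEntropy]
  linarith

theorem levelSet_nonempty (hc : c ∈ Set.range μ) : (levelSet μ c).Nonempty := by
  obtain ⟨i, hi⟩ := hc
  exact ⟨i, by simpa using hi⟩

theorem exists_lt_of_card_levelSet_lt (hc : ∀ j, μ j ≤ c)
    (h : (levelSet μ c).card < Fintype.card ι) : ∃ j, μ j < c := by
  by_contra! hle
  have (j : ι) : μ j = c := (hc j).antisymm (hle j)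
  simp [levelSet, this] at h

section Gibbs

variable [Nonempty ι]

theorem sum_exp_pos (μ : ι → ℝ) (γ : ℝ) : 0 < ∑ i, exp (γ * μ i) :=
  Finset.sum_pos (fun _ _ => exp_pos _) Finset.univ_nonempty

theorem gibbs_pos (μ : ι → ℝ) (γ : ℝ) (j : ι) : 0 < gibbs μ γ j :=
  div_pos (exp_pos _) (sum_exp_pos μ γ)

theorem gibbs_mem_stdSimplex (μ : ι → ℝ) (γ : ℝ) : gibbs μ γ ∈ stdSimplex ℝ ι := by
  refine ⟨fun j => (gibbs_pos μ γ j).le, ?_⟩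
  simp only [gibbs, ← Finset.sum_div]
  exact div_self (sum_exp_pos μ γ).ne'

theorem log_gibbs (μ : ι → ℝ) (γ : ℝ) (j : ι) :
    log (gibbs μ γ j) = γ * μ j - log (∑ i, exp (γ * μ i)) := by
  rw [gibbs, log_div (exp_pos _).ne' (sum_exp_pos μ γ).ne', log_exp]

theorem sum_mul_log_gibbs (hp : p ∈ stdSimplex ℝ ι) (μ : ι → ℝ) (γ : ℝ) :
    ∑ j, p j * log (gibbs μ γ j) = γ * (p ⬝ᵥ μ) - log (∑ i, exp (γ * μ i)) := by
  simp only [log_gibbs, mul_sub, Finset.sum_sub_distrib, ← Finset.sum_mul, hp.2, one_mul,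
    dotProduct, Finset.mul_sum, mul_left_comm]

theorem shannonEntropy_gibbs (μ : ι → ℝ) (γ : ℝ) :
    shannonEntropy (gibbs μ γ) = log (∑ i, exp (γ * μ i)) - γ * (gibbs μ γ ⬝ᵥ μ) := by
  have := sum_mul_log_gibbs (gibbs_mem_stdSimplex μ γ) μ γ
  simp only [shannonEntropy, negMulLog, neg_mul, Finset.sum_neg_distrib]
  linarith

theorem gibbs_variational (hp : p ∈ stdSimplex ℝ ι) (hne : p ≠ gibbs μ γ) :
    shannonEntropy p + γ * (p ⬝ᵥ μ)
      < shannonEntropy (gibbs μ γ) + γ * (gibbs μ γ ⬝ᵥ μ) := by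
  have := shannonEntropy_lt_neg_sum_mul_log hp (gibbs_mem_stdSimplex μ γ) (gibbs_pos μ γ) hne
  rw [sum_mul_log_gibbs hp] at this
  rw [shannonEntropy_gibbs]
  linarith

theorem isMaxOn_gibbs (μ : ι → ℝ) (hγ : 0 ≤ γ) :
    IsMaxOn (· ⬝ᵥ μ) (entropySuperlevel ι (shannonEntropy (gibbs μ γ))) (gibbs μ γ) := by
  rintro p ⟨hp, hent⟩
  rcases eq_or_ne p (gibbs μ γ) with rfl | hne
  · exact le_refl (gibbs μ γ ⬝ᵥ μ)
  · exact (lt_of_mul_lt_mul_left (by linarith [gibbs_variational hp hne]) hγ).le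

theorem gibbs_ne_gibbs (hij : μ i ≠ μ j) (hγ : γ ≠ γ') : gibbs μ γ ≠ gibbs μ γ' := by
  intro h
  have hi := congrArg log (congrFun h i)
  have hj := congrArg log (congrFun h j)
  rw [log_gibbs, log_gibbs] at hi hj
  have : (γ - γ') * (μ i - μ j) = 0 := by linarith
  exact mul_ne_zero (sub_ne_zero.2 hγ) (sub_ne_zero.2 hij) this

theorem strictMono_gibbs_dotProduct (hij : μ i ≠ μ j) :
    StrictMono fun γ => gibbs μ γ ⬝ᵥ μ := by
  intro γ γ' hlt
  have h := gibbs_variational (gibbs_mem_stdSimplex μ γ') (gibbs_ne_gibbs hij hlt.ne')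
  have h' := gibbs_variational (gibbs_mem_stdSimplex μ γ) (gibbs_ne_gibbs hij hlt.ne)
  exact lt_of_mul_lt_mul_left (a := γ' - γ) (by linarith) (sub_nonneg.2 hlt.le)

theorem strictAntiOn_shannonEntropy_gibbs (hij : μ i ≠ μ j) :
    StrictAntiOn (fun γ => shannonEntropy (gibbs μ γ)) (Set.Ici 0) := by
  intro γ hγ γ' _ hlt
  have h := gibbs_variational (gibbs_mem_stdSimplex μ γ') (gibbs_ne_gibbs hij hlt.ne')
  have hmean := mul_le_mul_of_nonneg_left (strictMono_gibbs_dotProduct hij hlt).le hγ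
  dsimp only at hmean ⊢
  linarith

theorem continuous_shannonEntropy_gibbs (μ : ι → ℝ) :
    Continuous fun γ => shannonEntropy (gibbs μ γ) := by
  refine continuous_finsetSum _ fun j _ => continuous_negMulLog.comp ?_
  exact Continuous.div (by fun_prop) (by fun_prop) fun γ => (sum_exp_pos μ γ).ne'

theorem gibbs_dotProduct_lt (hc : ∀ j, μ j ≤ c) (hi : μ i < c) (γ : ℝ) :
    gibbs μ γ ⬝ᵥ μ < c := by
  calc gibbs μ γ ⬝ᵥ μ < ∑ j, gibbs μ γ j * c :=
        Finset.sum_lt_sum (fun j _ => mul_le_mul_of_nonneg_left (hc j) (gibbs_pos μ γ j).le)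
          ⟨i, Finset.mem_univ i, mul_lt_mul_of_pos_left hi (gibbs_pos μ γ i)⟩
    _ = c := by rw [← Finset.sum_mul, (gibbs_mem_stdSimplex μ γ).2, one_mul]

end Gibbs

theorem dotProduct_le_of_mem_stdSimplex (hp : p ∈ stdSimplex ℝ ι) (hc : ∀ j, μ j ≤ c) :
    p ⬝ᵥ μ ≤ c :=
  calc p ⬝ᵥ μ ≤ ∑ j, p j * c :=
        Finset.sum_le_sum fun j _ => mul_le_mul_of_nonneg_left (hc j) (hp.1 j)
    _ = c := by rw [← Finset.sum_mul, hp.2, one_mul]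

section Uniform

variable [DecidableEq ι] {S : Finset ι}

theorem sum_uniformWeights_mul (S : Finset ι) (f : ι → ℝ) :
    ∑ j, uniformWeights S j * f j = (∑ j ∈ S, f j) / S.card := by
  simp [uniformWeights, Finset.mul_sum, div_eq_inv_mul]

theorem uniformWeights_mem_stdSimplex (hS : S.Nonempty) :
    uniformWeights S ∈ stdSimplex ℝ ι := by
  refine ⟨fun j => ?_, ?_⟩
  · rw [uniformWeights]
    positivity
  · have hcard : (S.card : ℝ) ≠ 0 := Nat.cast_ne_zero.2 hS.card_ne_zero
    simpa [hcard] using sum_uniformWeights_mul S 1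

theorem shannonEntropy_uniformWeights (hS : S.Nonempty) :
    shannonEntropy (uniformWeights S) = log S.card := by
  have (j : ι) : negMulLog (uniformWeights S j) = uniformWeights S j * log S.card := by
    rw [uniformWeights]
    split_ifs <;> simp [negMulLog]
  simp only [shannonEntropy, this, ← Finset.sum_mul, (uniformWeights_mem_stdSimplex hS).2, one_mul]

theorem gibbs_zero (μ : ι → ℝ) : gibbs μ 0 = uniformWeights Finset.univ := by
  ext j
  simp [gibbs, uniformWeights]

theorem uniformWeights_dotProduct (hc : c ∈ Set.range μ) :
    uniformWeights (levelSet μ c) ⬝ᵥ μ = c := by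
  have card_ne : ((levelSet μ c).card : ℝ) ≠ 0 :=
    Nat.cast_ne_zero.2 (levelSet_nonempty hc).card_ne_zero
  rw [dotProduct, sum_uniformWeights_mul,
    Finset.sum_congr rfl fun j hj => (Finset.mem_filter.1 hj).2, Finset.sum_const, nsmul_eq_mul,
    mul_div_cancel_left₀ _ card_ne]

/-- Dividing numerator and denominator by `e^{γ c}` leaves weights `e^{γ (μ_j - c)}`, which tend to
`1` where `μ_j = c` and to `0` elsewhere. -/
theorem tendsto_gibbs_atTop (hc : IsGreatest (Set.range μ) c) (j : ι) :
    Tendsto (fun γ => gibbs μ γ j) atTop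
      (𝓝 (uniformWeights (levelSet μ c) j)) := by
  have tendsto_exp (i : ι) :
      Tendsto (fun γ => exp (γ * (μ i - c))) atTop (𝓝 (if μ i = c then 1 else 0)) := by
    split_ifs with h
    · simp [h]
    · have hneg : μ i - c < 0 := sub_neg.2 (lt_of_le_of_ne (hc.2 (Set.mem_range_self i)) h)
      exact tendsto_exp_atBot.comp (tendsto_id.atTop_mul_const_of_neg hneg)
  have tendsto_sum : Tendsto (fun γ => ∑ i, exp (γ * (μ i - c))) atTop
      (𝓝 ((levelSet μ c).card : ℝ)) := by
    simpa using tendsto_finsetSum Finset.univ fun i _ => tendsto_exp i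
  have card_ne : ((levelSet μ c).card : ℝ) ≠ 0 :=
    Nat.cast_ne_zero.2 (levelSet_nonempty hc.1).card_ne_zero
  have limit_eq : (if μ j = c then 1 else 0) / ((levelSet μ c).card : ℝ)
      = uniformWeights (levelSet μ c) j := by
    simp [uniformWeights, ite_div]
  refine limit_eq ▸ ((tendsto_exp j).div tendsto_sum card_ne).congr fun γ => ?_
  simp only [Pi.div_apply, mul_sub, exp_sub, ← Finset.sum_div, gibbs]
  exact div_div_div_cancel_right₀ (exp_pos _).ne' _ _

end Uniform

theorem shannonEntropy_gibbs_zero [Nonempty ι] (μ : ι → ℝ) :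
    shannonEntropy (gibbs μ 0) = log (Fintype.card ι) := by
  classical
  rw [gibbs_zero, shannonEntropy_uniformWeights Finset.univ_nonempty, Finset.card_univ]

theorem pos_iff_shannonEntropy_gibbs_lt [Nonempty ι] (hij : μ i ≠ μ j) (hγ : 0 ≤ γ) :
    0 < γ ↔ shannonEntropy (gibbs μ γ) < log (Fintype.card ι) := by
  rw [← shannonEntropy_gibbs_zero μ]
  exact ((strictAntiOn_shannonEntropy_gibbs hij).lt_iff_gt hγ Set.self_mem_Ici).symm

theorem tendsto_shannonEntropy_gibbs_atTop (hc : IsGreatest (Set.range μ) c) :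
    Tendsto (fun γ => shannonEntropy (gibbs μ γ)) atTop
      (𝓝 (log (levelSet μ c).card)) := by
  classical
  rw [← shannonEntropy_uniformWeights (levelSet_nonempty hc.1)]
  exact tendsto_finsetSum _ fun j _ =>
    (continuous_negMulLog.tendsto _).comp (tendsto_gibbs_atTop hc j)

theorem exists_shannonEntropy_gibbs_eq (hc : IsGreatest (Set.range μ) c)
    (hs : log (levelSet μ c).card < s) (hs' : s ≤ log (Fintype.card ι)) :
    ∃ γ, 0 ≤ γ ∧ shannonEntropy (gibbs μ γ) = s := by
  have : Nonempty ι := Set.range_nonempty_iff_nonempty.1 hc.nonempty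
  obtain ⟨γ₁, hγ₁, hlt⟩ := ((eventually_ge_atTop (0 : ℝ)).and
    ((tendsto_shannonEntropy_gibbs_atTop hc).eventually_lt_const hs)).exists
  obtain ⟨γ, hγ, h⟩ := intermediate_value_Icc' hγ₁
    (continuous_shannonEntropy_gibbs μ).continuousOn
    ⟨hlt.le, hs'.trans_eq (shannonEntropy_gibbs_zero μ).symm⟩
  exact ⟨γ, hγ.1, h⟩

end Entropy

section Fin

variable {N : ℕ} {μ : Fin N → ℝ}

theorem gibbs_dotProduct_self (μ : Fin N → ℝ) (γ : ℝ) :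
    gibbs μ γ ⬝ᵥ μ = 1 / Z μ γ * ∑ j, μ j * Real.exp (γ * μ j) := by
  simp only [dotProduct, Finset.mul_sum, gibbs, Z]
  exact Finset.sum_congr rfl fun j _ => by ring

variable [NeZero N]

theorem entropyEq_iff (μ : Fin N → ℝ) (s γ : ℝ) :
    EntropyEq μ s γ ↔ shannonEntropy (gibbs μ γ) = s := by
  have : γ / Z μ γ * ∑ j, μ j * Real.exp (γ * μ j) = γ * (gibbs μ γ ⬝ᵥ μ) := by
    rw [gibbs_dotProduct_self]
    ring
  rw [EntropyEq, shannonEntropy_gibbs, this]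
  rfl

theorem isGreatest_range_of_antitone (hμ : Antitone μ) : IsGreatest (Set.range μ) (μ 0) :=
  ⟨Set.mem_range_self 0, Set.forall_mem_range.2 fun j => hμ (Fin.zero_le j)⟩

theorem lt_dMax_iff (hμ : Antitone μ) (j : Fin N) : (j : ℕ) < dMax μ ↔ μ j = μ 0 := by
  constructor
  · intro h
    by_contra hne
    have : levelSet μ (μ 0) ⊆ Finset.Iio j := by
      intro i hi
      rw [Finset.mem_filter] at hi
      rw [Finset.mem_Iio]
      by_contra! hji
      exact hne ((hμ (Fin.zero_le j)).antisymm (hi.2 ▸ hμ hji))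
    exact h.not_ge ((Finset.card_le_card this).trans_eq (Fin.card_Iio j))
  · intro h
    have : Finset.Iic j ⊆ levelSet μ (μ 0) := fun i hi =>
      Finset.mem_filter.2 ⟨Finset.mem_univ i,
        (hμ (Fin.zero_le i)).antisymm (h ▸ hμ (Finset.mem_Iic.1 hi))⟩
    exact (Fin.card_Iic j).symm.trans_le (Finset.card_le_card this)

theorem uniformWeights_levelSet (hμ : Antitone μ) :
    uniformWeights (levelSet μ (μ 0))
      = fun j : Fin N => if (j : ℕ) < dMax μ then 1 / (dMax μ : ℝ) else 0 := by
  ext j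
  simp only [lt_dMax_iff hμ, uniformWeights, Finset.mem_filter, Finset.mem_univ, true_and]
  rfl

end Fin

section Majorization

variable {ι : Type*} [LinearOrder ι]

theorem sum_mul_nonneg_of_partial_sums_nonneg {f z : ι → ℝ} (s : Finset ι)
    (hf : AntitoneOn f s) (hf0 : ∀ i ∈ s, 0 ≤ f i)
    (hz : ∀ k ∈ s, 0 ≤ ∑ i ∈ s with i ≤ k, z i) : 0 ≤ ∑ i ∈ s, f i * z i := by
  induction s using Finset.induction_on_max generalizing f with
  | empty => simp
  | insert a s hmax ih =>
    have ha : a ∉ s := fun h => (hmax a h).false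
    have partial_sums (k : ι) (hk : k ∈ s) : 0 ≤ ∑ i ∈ s with i ≤ k, z i := by
      have := hz k (Finset.mem_insert_of_mem hk)
      rwa [Finset.filter_insert, if_neg (hmax k hk).not_ge] at this
    have total_sum : 0 ≤ ∑ i ∈ insert a s, z i := by
      have := hz a (Finset.mem_insert_self a s)
      rwa [Finset.filter_true_of_mem fun i hi => (Finset.mem_insert.1 hi).elim Eq.le
        fun h => (hmax i h).le] at this
    have shifted : 0 ≤ ∑ i ∈ s, (f i - f a) * z i :=
      ih (fun i hi j hj hij => sub_le_sub_right (hf (by simp [Finset.mem_coe.1 hi])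
        (by simp [Finset.mem_coe.1 hj]) hij) _)
        (fun i hi => sub_nonneg.2 (hf (by simp [hi]) (by simp) (hmax i hi).le)) partial_sums
    calc 0 ≤ ∑ i ∈ s, (f i - f a) * z i + f a * ∑ i ∈ insert a s, z i :=
          add_nonneg shifted (mul_nonneg (hf0 a (Finset.mem_insert_self a s)) total_sum)
      _ = ∑ i ∈ insert a s, f i * z i := by
          simp only [Finset.sum_insert ha, sub_mul, Finset.sum_sub_distrib, Finset.mul_sum, mul_add]
          ring

variable [Fintype ι] [LocallyFiniteOrderBot ι]

theorem sum_mul_le_sum_mul_of_partial_sums_le {f x y : ι → ℝ} (hf : Antitone f)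
    (hf0 : ∀ i, 0 ≤ f i)
    (hxy : ∀ k, ∑ i ∈ Finset.Iic k, x i ≤ ∑ i ∈ Finset.Iic k, y i) :
    ∑ i, f i * x i ≤ ∑ i, f i * y i := by
  have := sum_mul_nonneg_of_partial_sums_nonneg (z := fun i => y i - x i) Finset.univ
    (hf.antitoneOn _) (fun i _ => hf0 i) fun k _ => by
      rw [Finset.filter_ge_eq_Iic, Finset.sum_sub_distrib]
      exact sub_nonneg.2 (hxy k)
  simpa only [mul_sub, Finset.sum_sub_distrib, sub_nonneg] using this

theorem sum_Iic_sum_Iic_le_sum_Iic_min {l : ι → ℝ} {W : ι → ι → ℝ} (hW : ∀ i j, 0 ≤ W i j)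
    (hrow : ∀ k, ∑ i ∈ Finset.Iic k, ∑ j, W i j ≤ ∑ i ∈ Finset.Iic k, l i)
    (hcol : ∀ k, ∑ j ∈ Finset.Iic k, ∑ i, W i j ≤ ∑ i ∈ Finset.Iic k, l i) (k m : ι) :
    ∑ i ∈ Finset.Iic k, ∑ j ∈ Finset.Iic m, W i j ≤ ∑ i ∈ Finset.Iic (min k m), l i := by
  rcases le_total k m with h | h
  · rw [min_eq_left h]
    exact (Finset.sum_le_sum fun i _ => Finset.sum_le_univ_sum_of_nonneg (hW i)).trans (hrow k)
  · rw [min_eq_right h, Finset.sum_comm]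
    exact (Finset.sum_le_sum fun j _ => Finset.sum_le_univ_sum_of_nonneg (hW · j)).trans (hcol m)

theorem sum_mul_mul_le_of_partial_sums_le {α β l : ι → ℝ} {W : ι → ι → ℝ}
    (hα : Antitone α) (hα0 : ∀ i, 0 ≤ α i) (hβ : Antitone β) (hβ0 : ∀ i, 0 ≤ β i)
    (hW : ∀ i j, 0 ≤ W i j)
    (hrow : ∀ k, ∑ i ∈ Finset.Iic k, ∑ j, W i j ≤ ∑ i ∈ Finset.Iic k, l i)
    (hcol : ∀ k, ∑ j ∈ Finset.Iic k, ∑ i, W i j ≤ ∑ i ∈ Finset.Iic k, l i) :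
    ∑ i, ∑ j, α i * β j * W i j ≤ ∑ i, α i * β i * l i := by
  have main : ∑ i, α i * ∑ j, β j * W i j ≤ ∑ i, α i * (β i * l i) := by
    refine sum_mul_le_sum_mul_of_partial_sums_le hα hα0 fun k => ?_
    calc ∑ i ∈ Finset.Iic k, ∑ j, β j * W i j = ∑ j, β j * ∑ i ∈ Finset.Iic k, W i j := by
          rw [Finset.sum_comm]
          simp only [Finset.mul_sum]
      _ ≤ ∑ j, β j * (if j ≤ k then l j else 0) := by
          refine sum_mul_le_sum_mul_of_partial_sums_le hβ hβ0 fun m => ?_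
          have Iic_inter : (Finset.Iic m).filter (· ≤ k) = Finset.Iic (min k m) := by
            ext j
            simp [and_comm]
          rw [Finset.sum_comm, ← Finset.sum_filter, Iic_inter]
          exact sum_Iic_sum_Iic_le_sum_Iic_min hW hrow hcol k m
      _ = ∑ i ∈ Finset.Iic k, β i * l i := by
          simp only [mul_ite, mul_zero, ← Finset.sum_filter, Finset.filter_ge_eq_Iic]
  simpa only [Finset.mul_sum, mul_assoc] using main

theorem sum_mul_le_sum_Iic {l c : ι → ℝ} (hl : Antitone l) (h0 : ∀ j, 0 ≤ c j)
    (h1 : ∀ j, c j ≤ 1) (k : ι) (hsum : ∑ j, c j = (Finset.Iic k).card) :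
    ∑ j, l j * c j ≤ ∑ j ∈ Finset.Iic k, l j := by
  have shifted : ∑ j, (l j - l k) * c j ≤ ∑ j ∈ Finset.Iic k, (l j - l k) := by
    rw [← Finset.filter_ge_eq_Iic, Finset.sum_filter]
    refine Finset.sum_le_sum fun j _ => ?_
    split_ifs with h
    · exact mul_le_of_le_one_right (sub_nonneg.2 (hl h)) (h1 j)
    · exact mul_nonpos_of_nonpos_of_nonneg (sub_nonpos.2 (hl (le_of_not_ge h))) (h0 j)
  simp only [sub_mul, Finset.sum_sub_distrib, ← Finset.mul_sum, hsum, Finset.sum_const,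
    nsmul_eq_mul] at shifted
  linarith

end Majorization

section Spectral

open Matrix

section Unitary

variable {m n ι : Type*} [Fintype n] [Fintype ι] [DecidableEq ι]

theorem re_mul_conjTranspose_self_apply (Y : Matrix m n ℂ) (i : m) :
    ((Y * Yᴴ) i i).re = ∑ j, ‖Y i j‖ ^ 2 := by
  simp only [mul_apply, conjTranspose_apply, Complex.re_sum, RCLike.star_def, Complex.mul_conj',
    ← Complex.ofReal_pow, Complex.ofReal_re]

theorem sum_norm_sq_row (U : unitaryGroup ι ℂ) (i : ι) :
    ∑ j, ‖(U : Op ι) i j‖ ^ 2 = 1 := by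
  rw [← re_mul_conjTranspose_self_apply, ← star_eq_conjTranspose,
    Unitary.mul_star_self_of_mem U.2, one_apply_eq, Complex.one_re]

theorem sum_norm_sq_col (U : unitaryGroup ι ℂ) (j : ι) :
    ∑ i, ‖(U : Op ι) i j‖ ^ 2 = 1 := by
  simpa [star_apply] using sum_norm_sq_row (star U) j

/-- The Hermitian operator with eigenvalues `d` whose eigenvectors are the columns of `U`. -/
noncomputable def conjDiagonal (U : unitaryGroup ι ℂ) (d : ι → ℝ) : Op ι :=
  (U : Op ι) * diagonal (fun j => (d j : ℂ)) * star (U : Op ι)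

theorem re_conjDiagonal_apply_self (U : unitaryGroup ι ℂ) (d : ι → ℝ) (i : ι) :
    (conjDiagonal U d i i).re
      = ∑ j, d j * ‖(U : Op ι) i j‖ ^ 2 := by
  rw [conjDiagonal, mul_apply, Complex.re_sum]
  refine Finset.sum_congr rfl fun j _ => ?_
  rw [mul_diagonal, star_apply, mul_right_comm, RCLike.star_def, Complex.mul_conj',
    mul_comm, ← Complex.ofReal_pow, ← Complex.ofReal_mul, Complex.ofReal_re]

/-- Schur's inequality: the squared moduli of the first `k` rows of `U` are weights at most `1`
of total mass `k`. -/
theorem sum_Iic_re_conjDiagonal_le [LinearOrder n] [LocallyFiniteOrderBot n]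
    (U : unitaryGroup n ℂ) {d : n → ℝ} (hd : Antitone d) (k : n) :
    ∑ i ∈ Finset.Iic k, (conjDiagonal U d i i).re
      ≤ ∑ i ∈ Finset.Iic k, d i := by
  simp only [re_conjDiagonal_apply_self]
  rw [Finset.sum_comm]
  simp only [← Finset.mul_sum]
  refine sum_mul_le_sum_Iic hd (fun j => Finset.sum_nonneg fun i _ => sq_nonneg _)
    (fun j => ?_) k ?_
  · rw [← sum_norm_sq_col U j]
    exact Finset.sum_le_univ_sum_of_nonneg fun i => sq_nonneg _
  · rw [Finset.sum_comm]
    simp [sum_norm_sq_row]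

theorem charpoly_unitary_conj (U : unitaryGroup ι ℂ) (M : Op ι) :
    ((U : Op ι) * M * star (U : Op ι)).charpoly = M.charpoly := by
  rw [charpoly_mul_comm, ← Matrix.mul_assoc, UnitaryGroup.star_mul_self, Matrix.one_mul]

theorem trace_unitary_conj (U : unitaryGroup ι ℂ) (M : Op ι) :
    ((U : Op ι) * M * star (U : Op ι)).trace = M.trace := by
  rw [trace_mul_comm, ← Matrix.mul_assoc, UnitaryGroup.star_mul_self, Matrix.one_mul]

theorem spectrum_real_conjDiagonal (U : unitaryGroup ι ℂ) (d : ι → ℝ) :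
    spectrum ℝ (conjDiagonal U d) = Set.range d := by
  ext x
  rw [conjDiagonal, ← spectrum.algebraMap_mem_iff ℂ]
  simp

theorem energy_conjDiagonal (U : unitaryGroup ι ℂ) (d : ι → ℝ) (ψ : EuclideanSpace ℂ ι) :
    energy (conjDiagonal U d) ψ
      = ∑ j, d j * ‖(star (U : Op ι) *ᵥ ψ.ofLp) j‖ ^ 2 := by
  have : star ψ.ofLp ᵥ* (U : Op ι) = star (star (U : Op ι) *ᵥ ψ.ofLp) := by
    rw [star_mulVec, star_eq_conjTranspose, conjTranspose_conjTranspose]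
  rw [energy, conjDiagonal, ← mulVec_mulVec, ← mulVec_mulVec, dotProduct_mulVec, this, dotProduct,
    Complex.re_sum]
  refine Finset.sum_congr rfl fun j _ => ?_
  rw [mulVec_diagonal, Pi.star_apply, mul_left_comm, RCLike.star_def, Complex.conj_mul',
    ← Complex.ofReal_pow, ← Complex.ofReal_mul, Complex.ofReal_re]

/-- The unitary matrix whose columns are the vectors of an orthonormal basis. -/
noncomputable def basisUnitary (a : OrthonormalBasis ι ℂ (EuclideanSpace ℂ ι)) :
    unitaryGroup ι ℂ :=
  ⟨(EuclideanSpace.basisFun ι ℂ).toBasis.toMatrix a.toBasis,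
    (EuclideanSpace.basisFun ι ℂ).toMatrix_orthonormalBasis_mem_unitary a⟩

theorem basisUnitary_apply (a : OrthonormalBasis ι ℂ (EuclideanSpace ℂ ι)) (i j : ι) :
    (basisUnitary a : Op ι) i j = a j i := by
  simp [basisUnitary, Module.Basis.toMatrix_apply]

end Unitary

variable {N : ℕ} {K : Op (Fin N)} {a : OrthonormalBasis (Fin N) ℂ (EuclideanSpace ℂ (Fin N))}

theorem sortedEigenvalue_antitone (hK : K.IsHermitian) : Antitone (sortedEigenvalue hK) :=
  fun _ _ h => hK.eigenvalues₀_antitone (by simpa using h)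

theorem exists_equiv_eigenvalues_eq (hK : K.IsHermitian) :
    ∃ e : Fin N ≃ Fin N, ∀ j, hK.eigenvalues (e j) = sortedEigenvalue hK j :=
  ⟨(finCongr (Fintype.card_fin N).symm).trans (Fintype.equivOfCardEq (Fintype.card_fin _)),
    fun j => by simp [sortedEigenvalue, IsHermitian.eigenvalues]⟩

theorem exists_isSortedEigenbasis (hK : K.IsHermitian) : ∃ a, IsSortedEigenbasis hK a := by
  obtain ⟨e, he⟩ := exists_equiv_eigenvalues_eq hK
  refine ⟨hK.eigenvectorBasis.reindex e.symm, fun j => ?_⟩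
  rw [OrthonormalBasis.reindex_apply, Equiv.symm_symm, hK.mulVec_eigenvectorBasis, he]
  rfl

theorem sortedEigenvalue_nonneg (hK : K.PosSemidef) (j : Fin N) :
    0 ≤ sortedEigenvalue hK.isHermitian j := by
  obtain ⟨e, he⟩ := exists_equiv_eigenvalues_eq hK.isHermitian
  exact he j ▸ hK.eigenvalues_nonneg (e j)

theorem sortedEigenvalue_congr {A B : Op (Fin N)} (hA : A.IsHermitian) (hB : B.IsHermitian)
    (h : A.charpoly = B.charpoly) : sortedEigenvalue hA = sortedEigenvalue hB := by
  have : hA.eigenvalues₀ = hB.eigenvalues₀ := by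
    rw [← List.ofFn_inj, ← hA.sort_roots_charpoly_eq_eigenvalues₀,
      ← hB.sort_roots_charpoly_eq_eigenvalues₀, h]
  ext j
  rw [sortedEigenvalue, sortedEigenvalue, this]

theorem map_eigenvalues_of_charpoly_eq {ι : Type*} [Fintype ι] [DecidableEq ι] {A : Op ι}
    (hA : A.IsHermitian) {l : ι → ℝ}
    (h : A.charpoly = (diagonal fun i => (l i : ℂ)).charpoly) :
    Finset.univ.val.map hA.eigenvalues = Finset.univ.val.map l := by
  have roots_eq := hA.roots_charpoly_eq_eigenvalues
  rw [h, charpoly_diagonal, Polynomial.roots_prod _ _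
    (by simp [Finset.prod_ne_zero_iff, Polynomial.X_sub_C_ne_zero])] at roots_eq
  simp only [Polynomial.roots_X_sub_C, Multiset.bind_singleton] at roots_eq
  have := congrArg (Multiset.map Complex.re) roots_eq
  simpa [Multiset.map_map, Function.comp_def] using this.symm

theorem vonNeumannEntropy_of_charpoly_eq (hK : K.IsHermitian) {l : Fin N → ℝ}
    (h : K.charpoly = (diagonal fun i => (l i : ℂ)).charpoly) :
    vonNeumannEntropy hK = shannonEntropy l := by
  have := congrArg (fun m => (m.map Real.negMulLog).sum) (map_eigenvalues_of_charpoly_eq hK h)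
  rw [Multiset.map_map, Multiset.map_map] at this
  simp only [vonNeumannEntropy, ← Finset.sum_neg_distrib, ← neg_mul]
  exact this

theorem IsSortedEigenbasis.eq_conjDiagonal {hK : K.IsHermitian} (h : IsSortedEigenbasis hK a) :
    K = conjDiagonal (basisUnitary a) (sortedEigenvalue hK) := by
  have : K * basisUnitary a
      = basisUnitary a * diagonal (fun j => (sortedEigenvalue hK j : ℂ)) := by
    ext i j
    rw [mul_diagonal, basisUnitary_apply, mul_comm, mul_apply]
    simp only [basisUnitary_apply]
    exact congrFun (h j) i
  rw [conjDiagonal, ← this, Matrix.mul_assoc, Unitary.mul_star_self_of_mem (basisUnitary a).2,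
    Matrix.mul_one]

theorem sum_Iic_re_diag_le_sum_sortedEigenvalue (hK : K.IsHermitian) (k : Fin N) :
    ∑ i ∈ Finset.Iic k, (K i i).re ≤ ∑ i ∈ Finset.Iic k, sortedEigenvalue hK i := by
  obtain ⟨a, ha⟩ := exists_isSortedEigenbasis hK
  have := sum_Iic_re_conjDiagonal_le (basisUnitary a) (sortedEigenvalue_antitone hK) k
  rwa [← ha.eq_conjDiagonal] at this

theorem vonNeumannEntropy_eq_shannonEntropy (hK : K.IsHermitian) :
    vonNeumannEntropy hK = shannonEntropy (sortedEigenvalue hK) := by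
  obtain ⟨a, ha⟩ := exists_isSortedEigenbasis hK
  refine vonNeumannEntropy_of_charpoly_eq hK ?_
  conv_lhs => rw [ha.eq_conjDiagonal, conjDiagonal, charpoly_unitary_conj]

theorem trace_eq_sum_sortedEigenvalue (hK : K.IsHermitian) :
    K.trace = ((∑ j, sortedEigenvalue hK j : ℝ) : ℂ) := by
  obtain ⟨a, ha⟩ := exists_isSortedEigenbasis hK
  conv_lhs => rw [ha.eq_conjDiagonal, conjDiagonal, trace_unitary_conj, trace_diagonal]
  rw [Complex.ofReal_sum]

theorem sortedEigenvalue_mem_entropySuperlevel (hK : K.PosSemidef) (htr : K.trace = 1) {s : ℝ}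
    (hs : s ≤ vonNeumannEntropy hK.isHermitian) :
    sortedEigenvalue hK.isHermitian ∈ entropySuperlevel (Fin N) s := by
  refine ⟨⟨sortedEigenvalue_nonneg hK, ?_⟩, ?_⟩
  · exact_mod_cast (trace_eq_sum_sortedEigenvalue hK.isHermitian).symm.trans htr
  · rwa [← vonNeumannEntropy_eq_shannonEntropy]

variable {Ka Kb : Op (Fin N)} {hKa : Ka.IsHermitian} {hKb : Kb.IsHermitian}
  {b : OrthonormalBasis (Fin N) ℂ (EuclideanSpace ℂ (Fin N))}

/-- The unitary matrix of the product basis `a_i ⊗ b_j`. -/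
noncomputable def productUnitary (a b : OrthonormalBasis (Fin N) ℂ (EuclideanSpace ℂ (Fin N))) :
    unitaryGroup (Fin N × Fin N) ℂ :=
  ⟨(basisUnitary a : Op (Fin N)) ⊗ₖ (basisUnitary b : Op (Fin N)),
    kronecker_mem_unitary (basisUnitary a).2 (basisUnitary b).2⟩

theorem kronecker_eq_conjDiagonal (ha : IsSortedEigenbasis hKa a)
    (hb : IsSortedEigenbasis hKb b) :
    Ka ⊗ₖ Kb = conjDiagonal (productUnitary a b)
      fun p => sortedEigenvalue hKa p.1 * sortedEigenvalue hKb p.2 := by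
  conv_lhs => rw [ha.eq_conjDiagonal, hb.eq_conjDiagonal]
  simp only [conjDiagonal, mul_kronecker_mul, diagonal_kronecker_diagonal, Complex.ofReal_mul,
    productUnitary, star_eq_conjTranspose, conjTranspose_kronecker]

/-- The products `μ_j = α_j β_j` of the eigenvalues of equal rank. -/
noncomputable def pairedEigenvalue (hKa : Ka.IsHermitian) (hKb : Kb.IsHermitian) (j : Fin N) : ℝ :=
  sortedEigenvalue hKa j * sortedEigenvalue hKb j

theorem pairedEigenvalue_antitone (hKa : Ka.PosSemidef) (hKb : Kb.PosSemidef) :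
    Antitone (pairedEigenvalue hKa.isHermitian hKb.isHermitian) :=
  fun _ _ h => mul_le_mul (sortedEigenvalue_antitone _ h) (sortedEigenvalue_antitone _ h)
    (sortedEigenvalue_nonneg hKb _) (sortedEigenvalue_nonneg hKa _)

theorem sigmaMax_kronecker [NeZero N] (hKa : Ka.PosSemidef) (hKb : Kb.PosSemidef) :
    sigmaMax (Ka ⊗ₖ Kb) = pairedEigenvalue hKa.isHermitian hKb.isHermitian 0 := by
  obtain ⟨a, ha⟩ := exists_isSortedEigenbasis hKa.isHermitian
  obtain ⟨b, hb⟩ := exists_isSortedEigenbasis hKb.isHermitian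
  rw [sigmaMax, kronecker_eq_conjDiagonal ha hb, spectrum_real_conjDiagonal]
  refine IsGreatest.csSup_eq ⟨⟨(0, 0), rfl⟩, Set.forall_mem_range.2 fun p => ?_⟩
  exact mul_le_mul (sortedEigenvalue_antitone _ (Fin.zero_le _))
    (sortedEigenvalue_antitone _ (Fin.zero_le _)) (sortedEigenvalue_nonneg hKb _)
    (sortedEigenvalue_nonneg hKa _)

end Spectral

section Coefficients

open Matrix

variable {N : ℕ}

/-- The coefficients of a bipartite ket in the standard product basis. -/
def coeffMatrix (ψ : EuclideanSpace ℂ (Fin N × Fin N)) : Op (Fin N) :=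
  Matrix.of fun i j => ψ (i, j)

/-- The coefficients of a bipartite ket in the product basis `a_i ⊗ b_j`. -/
noncomputable def schmidtCoeff (a b : OrthonormalBasis (Fin N) ℂ (EuclideanSpace ℂ (Fin N)))
    (ψ : EuclideanSpace ℂ (Fin N × Fin N)) : Op (Fin N) :=
  star (basisUnitary a : Op (Fin N)) * coeffMatrix ψ * star (basisUnitary b : Op (Fin N))ᵀ

variable (a b : OrthonormalBasis (Fin N) ℂ (EuclideanSpace ℂ (Fin N)))
  (ψ : EuclideanSpace ℂ (Fin N × Fin N))

theorem star_productUnitary_mulVec_apply (p : Fin N × Fin N) :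
    (star (productUnitary a b : Op (Fin N × Fin N)) *ᵥ ψ.ofLp) p = schmidtCoeff a b ψ p.1 p.2 := by
  have vec_eq : ψ.ofLp = vec (coeffMatrix ψ)ᵀ := rfl
  have transpose_eq : (basisUnitary b : Op (Fin N))ᴴ * (coeffMatrix ψ)ᵀ
      * (basisUnitary a : Op (Fin N))ᴴᵀ = (schmidtCoeff a b ψ)ᵀ := by
    simp only [schmidtCoeff, transpose_mul, star_eq_conjTranspose, Matrix.mul_assoc,
      conjTranspose_transpose]
    rfl
  rw [vec_eq, productUnitary, star_eq_conjTranspose, conjTranspose_kronecker, kronecker_mulVec_vec,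
    transpose_eq]
  rfl

theorem partialTraceB_vecMulVec :
    partialTraceB (vecMulVec ψ.ofLp (star ψ.ofLp)) = coeffMatrix ψ * (coeffMatrix ψ)ᴴ := rfl

theorem coeffMatrix_eq_mul_schmidtCoeff_mul :
    coeffMatrix ψ = (basisUnitary a : Op (Fin N)) * schmidtCoeff a b ψ
      * (basisUnitary b : Op (Fin N))ᵀ := by
  have hb := UnitaryGroup.star_mul_self (UnitaryGroup.transpose (basisUnitary b))
  rw [UnitaryGroup.transpose_coe] at hb
  simp only [schmidtCoeff, ← Matrix.mul_assoc, Unitary.mul_star_self_of_mem (basisUnitary a).2,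
    Matrix.one_mul]
  rw [Matrix.mul_assoc, hb, Matrix.mul_one]

theorem partialTraceB_eq_unitary_conj :
    partialTraceB (vecMulVec ψ.ofLp (star ψ.ofLp))
      = (basisUnitary a : Op (Fin N)) * (schmidtCoeff a b ψ * (schmidtCoeff a b ψ)ᴴ)
        * star (basisUnitary a : Op (Fin N)) := by
  have hb := Unitary.mul_star_self_of_mem (UnitaryGroup.transpose (basisUnitary b)).2
  rw [UnitaryGroup.transpose_coe, star_eq_conjTranspose] at hb
  rw [partialTraceB_vecMulVec, coeffMatrix_eq_mul_schmidtCoeff_mul a b ψ, conjTranspose_mul,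
    conjTranspose_mul, star_eq_conjTranspose]
  calc _ = (basisUnitary a : Op (Fin N)) * schmidtCoeff a b ψ
      * ((basisUnitary b : Op (Fin N))ᵀ * (basisUnitary b : Op (Fin N))ᵀᴴ)
      * ((schmidtCoeff a b ψ)ᴴ * (basisUnitary a : Op (Fin N))ᴴ) := by
        simp only [Matrix.mul_assoc]
    _ = _ := by
        rw [hb, Matrix.mul_one]
        simp only [Matrix.mul_assoc]

theorem charpoly_partialTraceB :
    (partialTraceB (vecMulVec ψ.ofLp (star ψ.ofLp))).charpoly
      = (schmidtCoeff a b ψ * (schmidtCoeff a b ψ)ᴴ).charpoly := by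
  rw [partialTraceB_eq_unitary_conj a b, charpoly_unitary_conj]

theorem trace_partialTraceB (ρ : Op (Fin N × Fin N)) : (partialTraceB ρ).trace = ρ.trace := by
  simp [partialTraceB, trace, Fintype.sum_prod_type]

variable {a b} {Ka Kb : Op (Fin N)} {hKa : Ka.IsHermitian} {hKb : Kb.IsHermitian}

theorem energy_eq_sum (ha : IsSortedEigenbasis hKa a) (hb : IsSortedEigenbasis hKb b) :
    energy (Ka ⊗ₖ Kb) ψ = ∑ i, ∑ j, sortedEigenvalue hKa i * sortedEigenvalue hKb j
      * ‖schmidtCoeff a b ψ i j‖ ^ 2 := by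
  rw [kronecker_eq_conjDiagonal ha hb, energy_conjDiagonal, Fintype.sum_prod_type]
  simp only [star_productUnitary_mulVec_apply]

theorem energy_le_sum_sortedEigenvalue (hKa : Ka.PosSemidef) (hKb : Kb.PosSemidef)
    (hρ : (vecMulVec ψ.ofLp (star ψ.ofLp)).IsHermitian) :
    energy (Ka ⊗ₖ Kb) ψ ≤ ∑ i, sortedEigenvalue hKa.isHermitian i *
      sortedEigenvalue hKb.isHermitian i * sortedEigenvalue (isHermitian_partialTraceB hρ) i := by
  obtain ⟨a, ha⟩ := exists_isSortedEigenbasis hKa.isHermitian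
  obtain ⟨b, hb⟩ := exists_isSortedEigenbasis hKb.isHermitian
  set Y := schmidtCoeff a b ψ
  have row_spectrum := sortedEigenvalue_congr (isHermitian_partialTraceB hρ)
    (isHermitian_mul_conjTranspose_self Y) (charpoly_partialTraceB a b ψ)
  have col_spectrum := sortedEigenvalue_congr (isHermitian_partialTraceB hρ)
    (isHermitian_mul_conjTranspose_self Yᵀ)
    ((charpoly_partialTraceB a b ψ).trans (by
      rw [charpoly_mul_comm, ← charpoly_transpose, transpose_mul]; rfl))
  rw [energy_eq_sum ψ ha hb]
  refine sum_mul_mul_le_of_partial_sums_le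
    (sortedEigenvalue_antitone _) (sortedEigenvalue_nonneg hKa)
    (sortedEigenvalue_antitone _) (sortedEigenvalue_nonneg hKb)
    (fun _ _ => sq_nonneg _) (fun k => ?_) fun k => ?_
  · simpa only [row_spectrum, re_mul_conjTranspose_self_apply]
      using sum_Iic_re_diag_le_sum_sortedEigenvalue (isHermitian_mul_conjTranspose_self Y) k
  · simpa only [col_spectrum, re_mul_conjTranspose_self_apply, transpose_apply]
      using sum_Iic_re_diag_le_sum_sortedEigenvalue (isHermitian_mul_conjTranspose_self Yᵀ) k

theorem exists_energy_le_dotProduct (hKa : Ka.PosSemidef) (hKb : Kb.PosSemidef) {s : ℝ}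
    (hψ : ψ ∈ kets N s) :
    ∃ p ∈ entropySuperlevel (Fin N) s,
      energy (Ka ⊗ₖ Kb) ψ ≤ p ⬝ᵥ pairedEigenvalue hKa.isHermitian hKb.isHermitian := by
  obtain ⟨hρ, htr, -, hs⟩ := hψ
  have hpos : (partialTraceB (vecMulVec ψ.ofLp (star ψ.ofLp))).PosSemidef :=
    partialTraceB_vecMulVec ψ ▸ posSemidef_self_mul_conjTranspose _
  refine ⟨_, sortedEigenvalue_mem_entropySuperlevel hpos
    ((trace_partialTraceB _).trans htr) hs, ?_⟩
  rw [dotProduct_comm]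
  exact energy_le_sum_sortedEigenvalue ψ hKa hKb hρ.isHermitian

section SchmidtState

variable {l : Fin N → ℝ}

theorem schmidtCoeff_schmidtState (a b : OrthonormalBasis (Fin N) ℂ (EuclideanSpace ℂ (Fin N)))
    (l : Fin N → ℝ) :
    schmidtCoeff a b (schmidtState a b l) = diagonal fun j => (√(l j) : ℂ) := by
  have coeff_eq : coeffMatrix (schmidtState a b l) = (basisUnitary a : Op (Fin N))
      * (diagonal fun j => (√(l j) : ℂ)) * (basisUnitary b : Op (Fin N))ᵀ := by
    ext i k
    rw [mul_apply]
    simp only [mul_diagonal, coeffMatrix, schmidtState, of_apply, transpose_apply,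
      basisUnitary_apply]
    exact Finset.sum_congr rfl fun j _ => by ring
  have hb := Unitary.mul_star_self_of_mem (UnitaryGroup.transpose (basisUnitary b)).2
  rw [UnitaryGroup.transpose_coe] at hb
  simp only [schmidtCoeff, coeff_eq, Matrix.mul_assoc, hb, Matrix.mul_one]
  rw [← Matrix.mul_assoc, UnitaryGroup.star_mul_self, Matrix.one_mul]

theorem energy_schmidtState (ha : IsSortedEigenbasis hKa a) (hb : IsSortedEigenbasis hKb b)
    (hl : ∀ j, 0 ≤ l j) :
    energy (Ka ⊗ₖ Kb) (schmidtState a b l) = l ⬝ᵥ pairedEigenvalue hKa hKb := by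
  rw [energy_eq_sum _ ha hb, schmidtCoeff_schmidtState]
  refine Finset.sum_congr rfl fun i _ => ?_
  rw [Finset.sum_eq_single i (fun j _ hj => by simp [diagonal_apply_ne' _ hj]) (by simp),
    diagonal_apply_eq, Complex.norm_real, Real.norm_eq_abs, sq_abs, Real.sq_sqrt (hl i), mul_comm,
    pairedEigenvalue]

theorem diagonal_sqrt_mul_conjTranspose (hl : ∀ j, 0 ≤ l j) :
    (diagonal fun j => (√(l j) : ℂ)) * (diagonal fun j => (√(l j) : ℂ))ᴴ
      = diagonal fun j => (l j : ℂ) := by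
  rw [diagonal_conjTranspose, diagonal_mul_diagonal]
  congr 1
  ext j
  rw [Pi.star_apply, RCLike.star_def, Complex.conj_ofReal, ← Complex.ofReal_mul,
    Real.mul_self_sqrt (hl j)]

theorem entanglementEntropy_schmidtState (hl : ∀ j, 0 ≤ l j)
    (hρ : (vecMulVec (schmidtState a b l).ofLp (star (schmidtState a b l).ofLp)).IsHermitian) :
    entanglementEntropy hρ = shannonEntropy l := by
  refine vonNeumannEntropy_of_charpoly_eq _ ?_
  rw [charpoly_partialTraceB a b, schmidtCoeff_schmidtState, diagonal_sqrt_mul_conjTranspose hl]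

theorem schmidtState_mem_kets {s : ℝ} (hl : l ∈ entropySuperlevel (Fin N) s) :
    schmidtState a b l ∈ kets N s := by
  have htr : (vecMulVec (schmidtState a b l).ofLp (star (schmidtState a b l).ofLp)).trace = 1 := by
    rw [← trace_partialTraceB, partialTraceB_eq_unitary_conj a b, trace_unitary_conj,
      schmidtCoeff_schmidtState, diagonal_sqrt_mul_conjTranspose hl.1.1, trace_diagonal]
    exact_mod_cast hl.1.2
  refine ⟨posSemidef_vecMulVec_self_star _, htr, ?_, ?_⟩
  · refine le_antisymm (rank_vecMulVec_le _ _) (Nat.one_le_iff_ne_zero.2 fun h => ?_)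
    rw [Matrix.rank, Submodule.finrank_eq_zero, LinearMap.range_eq_bot, ← mulVecLin_zero] at h
    rw [Matrix.toLin'.injective h, trace_zero] at htr
    exact zero_ne_one htr
  · exact hl.2.trans_eq (entanglementEntropy_schmidtState hl.1.1 _).symm

end SchmidtState

end Coefficients

section ClassicalMaximum

variable {N : ℕ} [NeZero N] {μ : Fin N → ℝ} {s : ℝ}

theorem uniformWeights_mem_entropySuperlevel (μ : Fin N → ℝ) (hs : s ≤ Real.log (dMax μ)) :
    uniformWeights (levelSet μ (μ 0)) ∈ entropySuperlevel (Fin N) s :=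
  have hne := levelSet_nonempty (Set.mem_range_self 0)
  ⟨uniformWeights_mem_stdSimplex hne, hs.trans_eq (shannonEntropy_uniformWeights hne).symm⟩

theorem isMaxOn_uniformWeights (hμ : Antitone μ) (s : ℝ) :
    IsMaxOn (· ⬝ᵥ μ) (entropySuperlevel (Fin N) s) (uniformWeights (levelSet μ (μ 0))) :=
  fun _ hq => (dotProduct_le_of_mem_stdSimplex hq.1 fun j => hμ (Fin.zero_le j)).trans_eq
    (uniformWeights_dotProduct (Set.mem_range_self 0)).symm

theorem exists_lt_of_log_dMax_lt (hμ : Antitone μ) (h : Real.log (dMax μ) < Real.log N) :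
    ∃ j, μ j < μ 0 := by
  refine exists_lt_of_card_levelSet_lt (fun j => hμ (Fin.zero_le j)) ?_
  rw [Fintype.card_fin]
  exact_mod_cast (Real.log_lt_log_iff
    (Nat.cast_pos.2 (levelSet_nonempty (Set.mem_range_self 0)).card_pos)
    (Nat.cast_pos.2 (NeZero.pos N))).1 h

theorem exists_shannonEntropy_gibbs_eq_of_antitone (hμ : Antitone μ) (hs : Real.log (dMax μ) < s)
    (hs' : s ≤ Real.log N) : ∃ γ, 0 ≤ γ ∧ shannonEntropy (gibbs μ γ) = s :=
  exists_shannonEntropy_gibbs_eq (isGreatest_range_of_antitone hμ) hs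
    (by rwa [Fintype.card_fin])

end ClassicalMaximum

section QuantumMaximum

open Matrix

theorem posSemidef_inducedObservable {κ O : Type*} [Fintype κ] [Fintype O] {N : ℕ}
    (E : QuantumChannel κ N) (M : POVM O N) (o : O) : (inducedObservable E M o).PosSemidef :=
  posSemidef_sum _ fun k _ => (M.posSemidef o).conjTranspose_mul_mul_same (E.kraus k)

variable {N : ℕ} {Ka Kb : Op (Fin N)} {s γ γ' : ℝ} {p : Fin N → ℝ}

theorem isGreatest_energy_of_isMaxOn (hKa : Ka.PosSemidef) (hKb : Kb.PosSemidef)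
    (hp : p ∈ entropySuperlevel (Fin N) s)
    (hmax : IsMaxOn (· ⬝ᵥ pairedEigenvalue hKa.isHermitian hKb.isHermitian)
      (entropySuperlevel (Fin N) s) p) :
    IsGreatest (energy (Ka ⊗ₖ Kb) '' kets N s)
      (p ⬝ᵥ pairedEigenvalue hKa.isHermitian hKb.isHermitian) := by
  constructor
  · obtain ⟨a, ha⟩ := exists_isSortedEigenbasis hKa.isHermitian
    obtain ⟨b, hb⟩ := exists_isSortedEigenbasis hKb.isHermitian
    exact ⟨schmidtState a b p, schmidtState_mem_kets hp, energy_schmidtState ha hb hp.1.1⟩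
  · rintro _ ⟨ψ, hψ, rfl⟩
    obtain ⟨q, hq, hle⟩ := exists_energy_le_dotProduct ψ hKa hKb hψ
    exact hle.trans (hmax hq)

theorem isOptimalWeight_of_isMaxOn (hKa : Ka.PosSemidef) (hKb : Kb.PosSemidef)
    (hp : p ∈ entropySuperlevel (Fin N) s)
    (hmax : IsMaxOn (· ⬝ᵥ pairedEigenvalue hKa.isHermitian hKb.isHermitian)
      (entropySuperlevel (Fin N) s) p) :
    IsOptimalWeight hKa.isHermitian hKb.isHermitian s p :=
  ⟨hp.1.1, hp.1.2, fun _ _ ha hb => ⟨schmidtState_mem_kets hp, fun _ hψ =>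
    ((isGreatest_energy_of_isMaxOn hKa hKb hp hmax).2 (Set.mem_image_of_mem _ hψ)).trans_eq
      (energy_schmidtState ha hb hp.1.1).symm⟩⟩

variable [NeZero N]

theorem isGreatest_energy_of_le_log_dMax (hKa : Ka.PosSemidef) (hKb : Kb.PosSemidef)
    (hs : s ≤ Real.log (dMax (pairedEigenvalue hKa.isHermitian hKb.isHermitian))) :
    IsGreatest (energy (Ka ⊗ₖ Kb) '' kets N s)
      (pairedEigenvalue hKa.isHermitian hKb.isHermitian 0) := by
  have := isGreatest_energy_of_isMaxOn hKa hKb (uniformWeights_mem_entropySuperlevel _ hs)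
    (isMaxOn_uniformWeights (pairedEigenvalue_antitone hKa hKb) s)
  rwa [uniformWeights_dotProduct (Set.mem_range_self 0)] at this

theorem isOptimalWeight_uniformWeights (hKa : Ka.PosSemidef) (hKb : Kb.PosSemidef)
    (hs : s ≤ Real.log (dMax (pairedEigenvalue hKa.isHermitian hKb.isHermitian))) :
    IsOptimalWeight hKa.isHermitian hKb.isHermitian s
      (uniformWeights (levelSet (pairedEigenvalue hKa.isHermitian hKb.isHermitian)
        (pairedEigenvalue hKa.isHermitian hKb.isHermitian 0))) :=
  isOptimalWeight_of_isMaxOn hKa hKb (uniformWeights_mem_entropySuperlevel _ hs)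
    (isMaxOn_uniformWeights (pairedEigenvalue_antitone hKa hKb) s)

theorem isGreatest_energy_gibbs (hKa : Ka.PosSemidef) (hKb : Kb.PosSemidef) (hγ : 0 ≤ γ)
    (hs : shannonEntropy (gibbs (pairedEigenvalue hKa.isHermitian hKb.isHermitian) γ) = s) :
    IsGreatest (energy (Ka ⊗ₖ Kb) '' kets N s)
      (gibbs (pairedEigenvalue hKa.isHermitian hKb.isHermitian) γ
        ⬝ᵥ pairedEigenvalue hKa.isHermitian hKb.isHermitian) := by
  subst hs
  exact isGreatest_energy_of_isMaxOn hKa hKb ⟨gibbs_mem_stdSimplex _ γ, le_rfl⟩ (isMaxOn_gibbs _ hγ)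

theorem isOptimalWeight_gibbs (hKa : Ka.PosSemidef) (hKb : Kb.PosSemidef) (hγ : 0 ≤ γ)
    (hs : shannonEntropy (gibbs (pairedEigenvalue hKa.isHermitian hKb.isHermitian) γ) = s) :
    IsOptimalWeight hKa.isHermitian hKb.isHermitian s
      (gibbs (pairedEigenvalue hKa.isHermitian hKb.isHermitian) γ) := by
  subst hs
  exact isOptimalWeight_of_isMaxOn hKa hKb ⟨gibbs_mem_stdSimplex _ γ, le_rfl⟩ (isMaxOn_gibbs _ hγ)

theorem Jmax_lt_of_log_dMax_lt (hKa : Ka.PosSemidef) (hKb : Kb.PosSemidef)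
    (hs : Real.log (dMax (pairedEigenvalue hKa.isHermitian hKb.isHermitian)) < s)
    (hs' : s ≤ Real.log N) :
    Jmax (Ka ⊗ₖ Kb) s < pairedEigenvalue hKa.isHermitian hKb.isHermitian 0 := by
  have hμ := pairedEigenvalue_antitone hKa hKb
  obtain ⟨j, hj⟩ := exists_lt_of_log_dMax_lt hμ (hs.trans_le hs')
  obtain ⟨γ, hγ, hent⟩ := exists_shannonEntropy_gibbs_eq_of_antitone hμ hs hs'
  rw [Jmax, (isGreatest_energy_gibbs hKa hKb hγ hent).csSup_eq]
  exact gibbs_dotProduct_lt (fun j => hμ (Fin.zero_le j)) hj γ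

theorem isGreatest_Jmax (hKa : Ka.PosSemidef) (hKb : Kb.PosSemidef) (hs : s ≤ Real.log N) :
    IsGreatest (energy (Ka ⊗ₖ Kb) '' kets N s) (Jmax (Ka ⊗ₖ Kb) s) := by
  suffices h : ∃ x, IsGreatest (energy (Ka ⊗ₖ Kb) '' kets N s) x by
    obtain ⟨x, hx⟩ := h
    rwa [Jmax, hx.csSup_eq]
  rcases le_or_gt s (Real.log (dMax (pairedEigenvalue hKa.isHermitian hKb.isHermitian)))
    with hlow | hhigh
  · exact ⟨_, isGreatest_energy_of_le_log_dMax hKa hKb hlow⟩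
  · obtain ⟨γ, hγ, hent⟩ :=
      exists_shannonEntropy_gibbs_eq_of_antitone (pairedEigenvalue_antitone hKa hKb) hhigh hs
    exact ⟨_, isGreatest_energy_gibbs hKa hKb hγ hent⟩

theorem strictAntiOn_Jmax (hKa : Ka.PosSemidef) (hKb : Kb.PosSemidef) :
    StrictAntiOn (Jmax (Ka ⊗ₖ Kb)) (Set.Icc
      (Real.log (dMax (pairedEigenvalue hKa.isHermitian hKb.isHermitian))) (Real.log N)) := by
  have hμ := pairedEigenvalue_antitone hKa hKb
  intro s hs t ht hst
  rcases hs.1.eq_or_lt with rfl | hs_high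
  · exact (Jmax_lt_of_log_dMax_lt hKa hKb hst ht.2).trans_eq
      (isGreatest_energy_of_le_log_dMax hKa hKb le_rfl).csSup_eq.symm
  · obtain ⟨j, hj⟩ := exists_lt_of_log_dMax_lt hμ (hs_high.trans_le hs.2)
    obtain ⟨γ, hγ, rfl⟩ := exists_shannonEntropy_gibbs_eq_of_antitone hμ hs_high hs.2
    obtain ⟨γ', hγ', rfl⟩ := exists_shannonEntropy_gibbs_eq_of_antitone hμ (hs_high.trans hst) ht.2
    have hlt : γ' < γ := ((strictAntiOn_shannonEntropy_gibbs hj.ne).lt_iff_gt hγ hγ').1 hst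
    rw [Jmax, Jmax, (isGreatest_energy_gibbs hKa hKb hγ rfl).csSup_eq,
      (isGreatest_energy_gibbs hKa hKb hγ' rfl).csSup_eq]
    exact strictMono_gibbs_dotProduct hj.ne hlt

end QuantumMaximum

end PrivacyEnergy

open PrivacyEnergy in
theorem mainTheorem1_general {N : ℕ} [NeZero N] {Ka Kb : Op (Fin N)}
    (hKa : Ka.PosSemidef) (hKb : Kb.PosSemidef) (μ : Fin N → ℝ)
    (hμ : μ = pairedEigenvalue hKa.isHermitian hKb.isHermitian) :
    (∀ s : ℝ, s ≤ Real.log N →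
      IsGreatest (energy (Ka ⊗ₖ Kb) '' kets N s) (Jmax (Ka ⊗ₖ Kb) s)) ∧
    (∀ s : ℝ, s ≤ Real.log (dMax μ) →
      Jmax (Ka ⊗ₖ Kb) s = μ 0 ∧ μ 0 = sigmaMax (Ka ⊗ₖ Kb) ∧
      IsOptimalWeight hKa.isHermitian hKb.isHermitian s
        (fun j => if (j : ℕ) < dMax μ then 1 / (dMax μ : ℝ) else 0)) ∧
    (∀ s : ℝ, Real.log (dMax μ) < s → s ≤ Real.log N →
      ∃ γ : ℝ, 0 ≤ γ ∧ (0 < γ ↔ s < Real.log N) ∧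
        EntropyEq μ s γ ∧
        (∀ γ' : ℝ, 0 ≤ γ' → EntropyEq μ s γ' → γ' = γ) ∧
        Jmax (Ka ⊗ₖ Kb) s = 1 / Z μ γ * ∑ j, μ j * Real.exp (γ * μ j) ∧
        Jmax (Ka ⊗ₖ Kb) s < sigmaMax (Ka ⊗ₖ Kb) ∧
        IsOptimalWeight hKa.isHermitian hKb.isHermitian s
          (fun j => Real.exp (γ * μ j) / Z μ γ)) ∧
    StrictAntiOn (Jmax (Ka ⊗ₖ Kb)) (Set.Icc (Real.log (dMax μ)) (Real.log N)) := by
  have hanti : Antitone μ := hμ ▸ pairedEigenvalue_antitone hKa hKb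
  subst hμ
  refine ⟨fun s hs => isGreatest_Jmax hKa hKb hs, fun s hs =>
    ⟨(isGreatest_energy_of_le_log_dMax hKa hKb hs).csSup_eq, (sigmaMax_kronecker hKa hKb).symm, ?_⟩,
    fun s hs hs' => ?_, strictAntiOn_Jmax hKa hKb⟩
  · rw [← uniformWeights_levelSet hanti]
    exact isOptimalWeight_uniformWeights hKa hKb hs
  · obtain ⟨j, hj⟩ := exists_lt_of_log_dMax_lt hanti (hs.trans_le hs')
    obtain ⟨γ, hγ, hent⟩ := exists_shannonEntropy_gibbs_eq_of_antitone hanti hs hs'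
    refine ⟨γ, hγ, ?_, (entropyEq_iff _ s γ).2 hent, fun γ' hγ' hent' => ?_,
      (isGreatest_energy_gibbs hKa hKb hγ hent).csSup_eq.trans (gibbs_dotProduct_self _ γ),
      (sigmaMax_kronecker hKa hKb).symm ▸ Jmax_lt_of_log_dMax_lt hKa hKb hs hs',
      isOptimalWeight_gibbs hKa hKb hγ hent⟩
    · rw [pos_iff_shannonEntropy_gibbs_lt hj.ne hγ, hent, Fintype.card_fin]
    · exact (strictAntiOn_shannonEntropy_gibbs hj.ne).injOn hγ' hγ
        (((entropyEq_iff _ s γ').1 hent').trans hent.symm)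


theorem mainTheorem1 {N : ℕ} [NeZero N] {κA κB OA OB : Type*}
    [Fintype κA] [Fintype κB] [Fintype OA] [Fintype OB]
    (EA : PrivacyEnergy.QuantumChannel κA N) (EB : PrivacyEnergy.QuantumChannel κB N)
    (MA : PrivacyEnergy.POVM OA N) (MB : PrivacyEnergy.POVM OB N) (a : OA) (b : OB)
    (K : PrivacyEnergy.Op (Fin N × Fin N))
    (hK : K = PrivacyEnergy.inducedObservable EA MA a ⊗ₖ PrivacyEnergy.inducedObservable EB MB b)
    (μ : Fin N → ℝ)
    (hμ : ∀ j, μ j =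
      PrivacyEnergy.sortedEigenvalue (PrivacyEnergy.isHermitian_inducedObservable EA MA a) j *
      PrivacyEnergy.sortedEigenvalue (PrivacyEnergy.isHermitian_inducedObservable EB MB b) j)
    (d : ℕ) (hd : d = PrivacyEnergy.dMax μ) :
    -- the maximum defining `Jmax` is attained
    (∀ s : ℝ, s ≤ Real.log N →
      IsGreatest (PrivacyEnergy.energy K '' PrivacyEnergy.kets N s) (PrivacyEnergy.Jmax K s)) ∧
    -- low-entanglement regime
    (∀ s : ℝ, s ≤ Real.log d →
      PrivacyEnergy.Jmax K s = μ 0 ∧ μ 0 = PrivacyEnergy.sigmaMax K ∧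
      PrivacyEnergy.IsOptimalWeight (PrivacyEnergy.isHermitian_inducedObservable EA MA a)
          (PrivacyEnergy.isHermitian_inducedObservable EB MB b) s
        (fun j => if (j : ℕ) < d then 1 / (d : ℝ) else 0)) ∧
    -- high-entanglement regime
    (∀ s : ℝ, Real.log d < s → s ≤ Real.log N →
      ∃ γ : ℝ, 0 ≤ γ ∧ (0 < γ ↔ s < Real.log N) ∧
        PrivacyEnergy.EntropyEq μ s γ ∧
        (∀ γ' : ℝ, 0 ≤ γ' → PrivacyEnergy.EntropyEq μ s γ' → γ' = γ) ∧
        PrivacyEnergy.Jmax K s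
          = 1 / PrivacyEnergy.Z μ γ * ∑ j, μ j * Real.exp (γ * μ j) ∧
        PrivacyEnergy.Jmax K s < PrivacyEnergy.sigmaMax K ∧
        PrivacyEnergy.IsOptimalWeight (PrivacyEnergy.isHermitian_inducedObservable EA MA a)
          (PrivacyEnergy.isHermitian_inducedObservable EB MB b) s
          (fun j => Real.exp (γ * μ j) / PrivacyEnergy.Z μ γ)) ∧
    -- strict monotonicity in `s`
    StrictAntiOn (PrivacyEnergy.Jmax K) (Set.Icc (Real.log d) (Real.log N)) := by
  subst hK hd
  exact mainTheorem1_general (PrivacyEnergy.posSemidef_inducedObservable EA MA a)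
    (PrivacyEnergy.posSemidef_inducedObservable EB MB b) μ (funext hμ)
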